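/- Let $H$ be a complex separable Hilbert space and let $B(H)$ be the algebra of bounded operators on $H$. Self-adjoint projections on $H$ are ordered by $P\le Q$ iff $PQ=P$; write $P^\perp=I-P$, and let $\vee$ and $\wedge$ denote suprema and infima of projections, i.e. the projections onto the closed linear span, respectively onto the intersection, of the ranges (so $\vee\emptyset=0$). A nest is a totally ordered, strongly closed lattice $\mathcal L$ of self-adjoint projections on $H$ with $0,I\in\mathcal L$; it is continuous if $P=\vee\{Q\in\mathcal L: Q<P\}$ for all $P\in\mathcal L$. The nest algebra $\mathcal T(\mathcal L)$ consists of all $A\in B(H)$ with $A(P(H))\subseteq P(H)$ for all $P\in\mathcal L$. A Lie $\mathcal T(\mathcal L)$-module is a linear subspace $\mathcal M$ of $B(H)$ such that $XA-AX\in\mathcal M$ for all $X\in\mathcal M$, $A\in\mathcal T(\mathcal L)$. For $T\in B(H)$ and $P\in\mathcal L$ put $$\varphi_T(P)=\vee\{P'\in\mathcal L: P^\perp TP'=0\},\qquad \psi_T(P)=\vee\{P'^\perp: P'\in\mathcal L,\ \varphi_T(P')=\varphi_T(P)\},$$ $$\sigma_T(P)=\vee\{P'\in\mathcal L:\varphi_T(P')=\varphi_T(P)\}.$$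 The kernel set of $T$ is $\Omega_T=\{(\varphi_T(P),\psi_T(P)): P\in\mathcal L\}$. Theorem. Let $\mathcal L$ be a continuous nest on $H$, let $\mathcal M$ be a norm closed Lie $\mathcal T(\mathcal L)$-module, let $T$ be a finite rank operator in $\mathcal M$, and let $(\Phi,\Psi)\in\Omega_T$. Then $\mathcal M$ contains every rank-$1$ operator in $\sigma_T(\Psi^\perp)\,B(H)\,\Phi^\perp=\{\sigma_T(\Psi^\perp)X\Phi^\perp: X\in B(H)\}$. -/

import Mathlib

noncomputable section

namespace NestLie

variable {H : Type*} [NormedAddCommGroup H] [InnerProductSpace ℂ H] [CompleteSpace H]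

/-- The order on self-adjoint projections: `P ≤ Q` if `PQ = P`. -/
def ProjLE (P Q : H →L[ℂ] H) : Prop := P * Q = P

/-- The strict order on self-adjoint projections. -/
def ProjLT (P Q : H →L[ℂ] H) : Prop := ProjLE P Q ∧ P ≠ Q

/-- The orthocomplement `P^⊥ = I - P`. -/
def perp (P : H →L[ℂ] H) : H →L[ℂ] H := 1 - P

/-- The supremum `∨ S` of a set of projections: the orthogonal projection onto the closed linear
span of their ranges (so the supremum of the empty set is `0`). -/
def projSup (S : Set (H →L[ℂ] H)) : H →L[ℂ] H :=
  (⨆ P ∈ S, P.range).topologicalClosure.starProjection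

/-- The infimum `P ∧ Q` of two projections: the orthogonal projection onto the intersection of
their ranges. That intersection is already closed; the closure is only there to make
completeness visible to Lean. -/
def projInf (P Q : H →L[ℂ] H) : H →L[ℂ] H :=
  (P.range ⊓ Q.range).topologicalClosure.starProjection

/-- A set of operators is strongly closed if it is closed in the strong operator topology, that is,
the topology on `B(H)` of pointwise norm convergence. -/
def IsStronglyClosed (L : Set (H →L[ℂ] H)) : Prop :=
  @IsClosed (H →L[ℂ] H)
    (TopologicalSpace.induced (fun T : H →L[ℂ] H => (T : H → H)) Pi.topologicalSpace) L

/-- A subspace lattice: a strongly closed lattice of self-adjoint projections containing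
`0` and `I`. -/
structure IsSubspaceLattice (L : Set (H →L[ℂ] H)) : Prop where
  isStarProjection : ∀ P ∈ L, IsStarProjection P
  zero_mem : 0 ∈ L
  one_mem : 1 ∈ L
  sup_mem : ∀ P ∈ L, ∀ Q ∈ L, projSup {P, Q} ∈ L
  inf_mem : ∀ P ∈ L, ∀ Q ∈ L, projInf P Q ∈ L
  strongly_closed : IsStronglyClosed L

/-- A nest: a totally ordered subspace lattice. -/
structure IsNest (L : Set (H →L[ℂ] H)) : Prop extends IsSubspaceLattice L where
  total : ∀ P ∈ L, ∀ Q ∈ L, ProjLE P Q ∨ ProjLE Q P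

/-- `P_- = ∨ {Q ∈ L : Q < P}`. -/
def predProj (L : Set (H →L[ℂ] H)) (P : H →L[ℂ] H) : H →L[ℂ] H :=
  projSup {Q | Q ∈ L ∧ ProjLT Q P}

/-- A continuous nest: a nest with `P_- = P` for all `P ∈ L`. -/
structure IsContinuousNest (L : Set (H →L[ℂ] H)) : Prop extends IsNest L where
  pred_eq : ∀ P ∈ L, predProj L P = P

/-- The algebra `T(L)` of all operators that leave the range of every `P ∈ L` invariant. -/
def nestAlgebra (L : Set (H →L[ℂ] H)) : Subalgebra ℂ (H →L[ℂ] H) where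
  carrier := {T | ∀ P ∈ L, ∀ x ∈ P.range, T x ∈ P.range}
  mul_mem' := fun ha hb P hP x hx => ha P hP _ (hb P hP x hx)
  add_mem' := fun ha hb P hP x hx => P.range.add_mem (ha P hP x hx) (hb P hP x hx)
  algebraMap_mem' := fun c P _ _ hx => P.range.smul_mem c hx

/-- A linear subspace `M` of `B(H)` is a Lie `T(L)`-module if `[M, T(L)] ⊆ M`, where
`[A, B] = AB - BA`. -/
def IsLieNestModule (L : Set (H →L[ℂ] H)) (M : Submodule ℂ (H →L[ℂ] H)) : Prop :=
  ∀ X ∈ M, ∀ A ∈ nestAlgebra L, X * A - A * X ∈ M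

/-- The lattice `L^⊥ = {P^⊥ : P ∈ L}`. -/
def perpLattice (L : Set (H →L[ℂ] H)) : Set (H →L[ℂ] H) := perp '' L

/-- `BIL(T, L) = {(P, Q) ∈ L × L^⊥ : QTP = 0}`. -/
def BIL (T : H →L[ℂ] H) (L : Set (H →L[ℂ] H)) : Set ((H →L[ℂ] H) × (H →L[ℂ] H)) :=
  {p | p.1 ∈ L ∧ p.2 ∈ perpLattice L ∧ p.2 * T * p.1 = 0}

/-- `φ_T(P) = ∨ {P' ∈ L : (P', P^⊥) ∈ BIL(T, L)}`. -/
def phi (T : H →L[ℂ] H) (L : Set (H →L[ℂ] H)) (P : H →L[ℂ] H) : H →L[ℂ] H :=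
  projSup {P' | P' ∈ L ∧ (P', perp P) ∈ BIL T L}

/-- `ψ_T(P) = ∨ {P'^⊥ : P' ∈ L, φ_T(P') = φ_T(P)}`. -/
def psi (T : H →L[ℂ] H) (L : Set (H →L[ℂ] H)) (P : H →L[ℂ] H) : H →L[ℂ] H :=
  projSup (perp '' {P' | P' ∈ L ∧ phi T L P' = phi T L P})

/-- The kernel map `ω_T(P) = (φ_T(P), ψ_T(P))`. -/
def kernelMap (T : H →L[ℂ] H) (L : Set (H →L[ℂ] H)) (P : H →L[ℂ] H) :
    (H →L[ℂ] H) × (H →L[ℂ] H) :=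
  (phi T L P, psi T L P)

/-- The kernel set `Ω_T`: the image of `L` under the kernel map. -/
def kernelSet (T : H →L[ℂ] H) (L : Set (H →L[ℂ] H)) : Set ((H →L[ℂ] H) × (H →L[ℂ] H)) :=
  kernelMap T L '' L

/-- `σ_T(P) = ∨ {P' ∈ L : φ_T(P') = φ_T(P)}`. -/
def sigmaProj (T : H →L[ℂ] H) (L : Set (H →L[ℂ] H)) (P : H →L[ℂ] H) : H →L[ℂ] H :=
  projSup {P' | P' ∈ L ∧ phi T L P' = phi T L P}

/-- The operator `T` has finite rank. -/
def IsFiniteRank (T : H →L[ℂ] H) : Prop := FiniteDimensional ℂ T.range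

/-- The operator `A` has rank one. -/
def IsRankOne (A : H →L[ℂ] H) : Prop := Module.finrank ℂ A.range = 1

/-- The set `P B(H) Q = {P X Q : X ∈ B(H)}`. -/
def corner (P Q : H →L[ℂ] H) : Set (H →L[ℂ] H) := Set.range fun X : H →L[ℂ] H => P * X * Q

end NestLie

end

/-!
The notation `x ⊗ y` stands for the rank-one operator `z ↦ ⟪y, z⟫ x`. A rank-one operator in
`σ_T(Ψ^⊥) B(H) Φ^⊥` has the form `x ⊗ y` with `x` in the range of `σ_T(Ψ^⊥)` and `y` orthogonal to
the range of `Φ`. By definition `x` lies in the closed span of the ranges of the `P ∈ L` with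
`φ_T(P) = φ_T(Ψ^⊥)`. By continuity of the nest, `Φ` is the infimum of the `Q ∈ L` with `Q ≰ Φ`, so
`y` lies in the closed span of the ranges of the corresponding `Q^⊥`
(`IsContinuousNest.mem_closure_of_apply_eq_zero`). As `M` is closed, one may take `x = P x` and
`y = Q^⊥ y` for one such `P` and one such `Q`. The definition of `φ_T` gives `P^⊥ T Q ≠ 0`
(`perp_mul_mul_ne_zero`), so it remains to see that a nonzero corner `P^⊥ T Q` puts all of
`P B(H) Q^⊥` of rank one into `M` (`IsLieNestModule.rankOne_mem`).

If `u = Q u` and `v = P^⊥ v`, then `x ⊗ v` and `u ⊗ y` belong to the nest algebra, and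
`(x ⊗ v) T (u ⊗ y) = ⟪v, T u⟫ x ⊗ y`. A Lie module only contains the double commutator, which has
three more terms, with coefficients `⟪y, T x⟫`, `⟪v, u⟫` and `⟪y, x⟫`
(`IsLieNestModule.rankOne_combination_mem`). They are removed as follows.

* If `P ≤ Q`, then `⟪y, x⟫ = 0`. If `Q^⊥ T P ≠ 0`, one can take `u = P u` and `v = Q^⊥ v`; then the
  third coefficient vanishes, and the case `x = u`, `y = v` gives `u ⊗ v ∈ M`, which disposes of the
  other term. If `Q^⊥ T P = 0`, then `⟪y, T x⟫ = 0`, and `u`, `v` can be chosen with `⟪v, u⟫ = 0`,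
  since the finite-rank operator `P^⊥ T Q` is not a nonzero multiple of `P^⊥ Q`: the intervals of a
  continuous nest are infinite-dimensional (`IsContinuousNest.not_finiteDimensional`).
* If `Q < P`, then `P^⊥ T P` and `Q^⊥ T Q` are nonzero as well, and the first case applied to the
  pairs `(P, P)` and `(Q, Q)` reduces the claim to `x` and `y` in the range of `P - Q`. After
  replacing `T` by `P^⊥ T Q ∈ M`, only `⟪v, T u⟫ x ⊗ y - ⟪y, x⟫ B` with a fixed `B` is left.
  Averages over many orthonormal vectors `x = y` converge to `-B` in norm, so `B ∈ M`
  (`IsLieNestModule.rankOne_mem_of_mem_interval`).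
-/

namespace NestLie

open InnerProductSpace Filter Topology

variable {H : Type*} [NormedAddCommGroup H] [InnerProductSpace ℂ H]

/-! ### Submodules of infinite dimension -/

/-- Finitely many linear conditions are satisfied by a nonzero vector of an infinite-dimensional
subspace: here those are `T w = 0` for `T` of finite rank and orthogonality to two vectors. -/
theorem exists_ne_zero_mem_ker_orthogonal {W : Submodule ℂ H} (hW : ¬ FiniteDimensional ℂ W)
    {T : H →L[ℂ] H} (hT : IsFiniteRank T) (s t : H) :
    ∃ w ∈ W, w ≠ 0 ∧ T w = 0 ∧ inner ℂ s w = 0 ∧ inner ℂ t w = 0 := by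
  by_contra! hcon
  have : FiniteDimensional ℂ T.range := hT
  let f : W →ₗ[ℂ] T.range × ℂ × ℂ :=
    ((T : H →ₗ[ℂ] H).rangeRestrict.prod
      ((innerSL ℂ s : H →ₗ[ℂ] ℂ).prod (innerSL ℂ t : H →ₗ[ℂ] ℂ))).comp W.subtype
  have hf : Function.Injective f := by
    rw [← LinearMap.ker_eq_bot, LinearMap.ker_eq_bot']
    intro w hw
    by_contra hne
    have h1 : T w = 0 := congrArg (fun z => (z.1 : H)) hw
    have h2 : inner ℂ s (w : H) = 0 := congrArg (fun z => z.2.1) hw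
    have h3 : inner ℂ t (w : H) = 0 := congrArg (fun z => z.2.2) hw
    exact hcon w w.2 (by simpa using hne) h1 h2 h3
  exact hW (Module.Finite.of_injective f hf)

theorem exists_finrank_eq_of_not_finiteDimensional {W : Submodule ℂ H}
    (hW : ¬ FiniteDimensional ℂ W) (n : ℕ) :
    ∃ K ≤ W, FiniteDimensional ℂ K ∧ Module.finrank ℂ K = n := by
  have hr : (n : Cardinal) ≤ Module.rank ℂ W := by
    by_contra! h
    exact hW (Module.rank_lt_aleph0_iff.mp (h.trans Cardinal.natCast_lt_aleph0))
  obtain ⟨s, hs, hli⟩ := exists_finset_linearIndependent_of_le_rank hr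
  have hli' : LinearIndependent ℂ (fun i : s => ((i : W) : H)) :=
    hli.map' W.subtype W.ker_subtype
  refine ⟨Submodule.span ℂ (Set.range fun i : s => ((i : W) : H)), ?_, ?_, ?_⟩
  · rw [Submodule.span_le]
    rintro _ ⟨i, rfl⟩
    exact (i : W).2
  · exact FiniteDimensional.span_of_finite ℂ (Set.finite_range _)
  · rw [finrank_span_eq_card hli', Fintype.card_coe, hs]

/-! ### Rank-one operators -/

theorem IsRankOne.exists_eq_rankOne [CompleteSpace H] {A : H →L[ℂ] H} (hA : IsRankOne A) :
    ∃ z : H, ∃ c : ℂ, A = rankOne ℂ (A z) (c • ContinuousLinearMap.adjoint A (A z)) := by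
  obtain ⟨⟨_, z, rfl⟩, hne, hspan⟩ := finrank_eq_one_iff'.mp hA
  have hz : inner ℂ (A z) (A z) ≠ (0 : ℂ) :=
    inner_self_ne_zero.mpr fun h0 => hne (Subtype.ext h0)
  refine ⟨z, (inner ℂ (A z) (A z))⁻¹, ?_⟩
  ext w
  obtain ⟨k, hk⟩ := hspan ⟨A w, w, rfl⟩
  have hk' : k • A z = A w := congrArg Subtype.val hk
  rw [rankOne_apply, inner_smul_left, ContinuousLinearMap.adjoint_inner_left, ← hk',
    inner_smul_right, map_inv₀, inner_conj_symm, mul_comm k, ← mul_assoc, inv_mul_cancel₀ hz,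
    one_mul]

/-- A closed subspace contains `x ⊗ y` for all `x` in the closed span of a family of subspaces as
soon as it does so for `x` in each of them, and likewise for `y`. -/
theorem rankOne_mem_of_mem_closure {M : Submodule ℂ (H →L[ℂ] H)}
    (hMcl : IsClosed (M : Set (H →L[ℂ] H)))
    {S S' : Set (H →L[ℂ] H)} {f g : (H →L[ℂ] H) → Submodule ℂ H}
    (h : ∀ P ∈ S, ∀ Q ∈ S', ∀ x ∈ f P, ∀ y ∈ g Q, rankOne ℂ x y ∈ M) {x y : H}
    (hx : x ∈ (⨆ P ∈ S, f P).topologicalClosure) (hy : y ∈ (⨆ Q ∈ S', g Q).topologicalClosure) :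
    rankOne ℂ x y ∈ M := by
  -- `F y` is `x ↦ x ⊗ y` as a continuous linear map.
  let F (y : H) : H →L[ℂ] H →L[ℂ] H := ContinuousLinearMap.smulRightL ℂ H H (innerSL ℂ y)
  have hF : ∀ x y, F y x = rankOne ℂ x y := fun x y => rfl
  have right : ∀ P ∈ S, ∀ x ∈ f P, ∀ y ∈ ⨆ Q ∈ S', g Q, rankOne ℂ x y ∈ M := by
    intro P hP x hx
    let N : Submodule ℂ H := M.comap (rankOne ℂ x).toLinearMap
    have hN : ⨆ Q ∈ S', g Q ≤ N := iSup₂_le fun Q hQ z hz => h P hP Q hQ x hx z hz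
    exact fun y hy => hN hy
  have left : ∀ y ∈ ⨆ Q ∈ S', g Q, rankOne ℂ x y ∈ M := by
    intro y hy
    let N : Submodule ℂ H := M.comap (F y).toLinearMap
    have hN : ⨆ P ∈ S, f P ≤ N := iSup₂_le fun P hP z hz => by
      change F y z ∈ M
      exact (hF z y).symm ▸ right P hP z hz y hy
    have hcl : F y x ∈ closure (M : Set (H →L[ℂ] H)) :=
      map_mem_closure (F y).continuous hx fun x hx => hN hx
    rwa [hMcl.closure_eq] at hcl
  have hcl : rankOne ℂ x y ∈ closure (M : Set (H →L[ℂ] H)) :=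
    map_mem_closure (rankOne ℂ x).continuous hy left
  rwa [hMcl.closure_eq] at hcl

/-! ### Projections, their order and their suprema -/

section Projections

variable {P Q : H →L[ℂ] H}

theorem ProjLE.apply_eq_zero (h : ProjLE P Q) {y : H} (hy : Q y = 0) : P y = 0 := by
  rw [← h]
  change P (Q y) = 0
  rw [hy, map_zero]

variable [CompleteSpace H]

theorem apply_apply_of_isStarProjection (hP : IsStarProjection P) (x : H) : P (P x) = P x :=
  congrArg (fun A : H →L[ℂ] H => A x) hP.isIdempotentElem.eq

theorem inner_apply_of_isStarProjection (hP : IsStarProjection P) (x y : H) :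
    inner ℂ (P x) y = inner ℂ x (P y) := by
  have h : ContinuousLinearMap.adjoint P = P := hP.isSelfAdjoint
  conv_lhs => rw [← h]
  exact ContinuousLinearMap.adjoint_inner_left P y x

theorem inner_eq_zero_of_isStarProjection (hP : IsStarProjection P) {x y : H} (hx : P x = x)
    (hy : P y = 0) : inner ℂ y x = 0 := by
  rw [← hx, ← inner_apply_of_isStarProjection hP, hy, inner_zero_left]

theorem mem_range_iff_of_isStarProjection (hP : IsStarProjection P) {x : H} :
    x ∈ P.range ↔ P x = x :=
  ⟨fun ⟨z, hz⟩ => hz ▸ apply_apply_of_isStarProjection hP z, fun h => ⟨x, h⟩⟩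

theorem ProjLE.apply_eq_self (hP : IsStarProjection P) (hQ : IsStarProjection Q)
    (h : ProjLE P Q) {x : H} (hx : P x = x) : Q x = x := by
  have h' : Q * P = P := by
    have := congrArg star h
    rwa [star_mul, hP.isSelfAdjoint.star_eq, hQ.isSelfAdjoint.star_eq] at this
  rw [← hx]
  exact congrArg (fun A : H →L[ℂ] H => A x) h'

theorem projLE_of_forall_apply_eq_self (hP : IsStarProjection P) (hQ : IsStarProjection Q)
    (h : ∀ x, P x = x → Q x = x) : ProjLE P Q := by
  have h' : Q * P = P := by
    ext x
    exact h (P x) (apply_apply_of_isStarProjection hP x)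
  have := congrArg star h'
  rwa [star_mul, hP.isSelfAdjoint.star_eq, hQ.isSelfAdjoint.star_eq] at this

theorem projLE_antisymm (hP : IsStarProjection P) (hQ : IsStarProjection Q)
    (h : ProjLE P Q) (h' : ProjLE Q P) : P = Q := by
  have := congrArg star h
  rw [star_mul, hP.isSelfAdjoint.star_eq, hQ.isSelfAdjoint.star_eq] at this
  exact this.symm.trans h'

theorem projSup_isStarProjection (S : Set (H →L[ℂ] H)) : IsStarProjection (projSup S) :=
  isStarProjection_starProjection

theorem range_projSup (S : Set (H →L[ℂ] H)) :
    (projSup S).range = (⨆ P ∈ S, P.range).topologicalClosure :=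
  Submodule.range_starProjection _

theorem range_projSup_le {S : Set (H →L[ℂ] H)} {K : Submodule ℂ H} (hK : IsClosed (K : Set H))
    (h : ∀ P ∈ S, P.range ≤ K) : (projSup S).range ≤ K := by
  rw [range_projSup]
  exact Submodule.topologicalClosure_minimal _ (iSup₂_le h) hK

theorem projLE_projSup {S : Set (H →L[ℂ] H)} (hP : IsStarProjection P) (hPS : P ∈ S) :
    ProjLE P (projSup S) := by
  refine projLE_of_forall_apply_eq_self hP (projSup_isStarProjection S) fun x hx => ?_
  rw [← mem_range_iff_of_isStarProjection (projSup_isStarProjection S), range_projSup]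
  exact Submodule.le_topologicalClosure _
    ((le_iSup₂ (f := fun (P : H →L[ℂ] H) (_ : P ∈ S) => P.range) P hPS) ⟨x, hx⟩)

theorem projSup_projLE {S : Set (H →L[ℂ] H)} (hQ : IsStarProjection Q)
    (h : ∀ P ∈ S, IsStarProjection P ∧ ProjLE P Q) : ProjLE (projSup S) Q := by
  refine projLE_of_forall_apply_eq_self (projSup_isStarProjection S) hQ fun x hx => ?_
  have hcl : IsClosed (Q.range : Set H) :=
    ContinuousLinearMap.IsIdempotentElem.isClosed_range hQ.isIdempotentElem
  refine (mem_range_iff_of_isStarProjection hQ).mp (range_projSup_le (S := S) hcl ?_ ⟨x, hx⟩)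
  intro P hPS y hy
  exact (mem_range_iff_of_isStarProjection hQ).mpr ((h P hPS).2.apply_eq_self (h P hPS).1 hQ
    ((mem_range_iff_of_isStarProjection (h P hPS).1).mp hy))

end Projections

/-! ### Continuous nests -/

section Nest

variable [CompleteSpace H] {L : Set (H →L[ℂ] H)}

/-- A nest contains the infimum of each of its subsets. That infimum is the projection onto the
orthogonal complement of all ranges of complements `P^⊥`, hence the strong limit of the decreasing
net `P`. -/
theorem IsNest.starProjection_orthogonal_mem (hL : IsNest L) {S : Set (H →L[ℂ] H)} (hS : S ⊆ L) :
    (⨆ P ∈ S, (perp P).range)ᗮ.starProjection ∈ L := by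
  rcases S.eq_empty_or_nonempty with rfl | hne
  · simpa [Submodule.starProjection_top, ← ContinuousLinearMap.one_def] using hL.one_mem
  have hproj : ∀ P ∈ L, IsStarProjection (perp P) := fun P hP =>
    (hL.isStarProjection P hP).one_sub
  -- The net is indexed by the subspaces `range P^⊥` themselves, which increase as `P` decreases.
  let 𝒦 : Set (Submodule ℂ H) := (fun P : H →L[ℂ] H => (perp P).range) '' S
  have : Nonempty 𝒦 := (hne.image _).to_subtype
  have hdir : IsDirected 𝒦 (· ≤ ·) := by
    refine ⟨?_⟩
    rintro ⟨_, P, hP, rfl⟩ ⟨_, Q, hQ, rfl⟩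
    have key : ∀ P ∈ S, ∀ Q ∈ S, ProjLE P Q → (perp Q).range ≤ (perp P).range := by
      intro P hP Q hQ h x hx
      rw [mem_range_iff_of_isStarProjection (hproj _ (hS hP))]
      rw [mem_range_iff_of_isStarProjection (hproj _ (hS hQ))] at hx
      have hx' : Q x = 0 := by simpa [perp] using hx
      simp [perp, h.apply_eq_zero hx']
    rcases hL.total P (hS hP) Q (hS hQ) with h | h
    · exact ⟨⟨_, P, hP, rfl⟩, le_rfl, key P hP Q hQ h⟩
    · exact ⟨⟨_, Q, hQ, rfl⟩, key Q hQ P hP h, le_rfl⟩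
  have hmem : ∀ K : 𝒦, ∃ P ∈ S, (K : Submodule ℂ H) = (perp P).range := by
    rintro ⟨_, P, hP, rfl⟩
    exact ⟨P, hP, rfl⟩
  have hperp : ∀ K : 𝒦, ∃ _ : (K : Submodule ℂ H).HasOrthogonalProjection,
      1 - (K : Submodule ℂ H).starProjection ∈ L := by
    rintro ⟨_, P, hP, rfl⟩
    obtain ⟨h1, h2⟩ := isStarProjection_iff_eq_starProjection_range.mp (hproj P (hS hP))
    refine ⟨h1, ?_⟩
    rw [← h2]
    simpa [perp] using hS hP
  have : ∀ K : 𝒦, (K : Submodule ℂ H).HasOrthogonalProjection := fun K => (hperp K).1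
  have hsup : ⨆ P ∈ S, (perp P).range = ⨆ K : 𝒦, (K : Submodule ℂ H) := by
    rw [iSup_subtype, iSup_image]
  have hlim := fun x => Submodule.starProjection_tendsto_closure_iSup
    (fun K : 𝒦 => (K : Submodule ℂ H)) (fun _ _ h => h) x
  have hG : (⨆ P ∈ S, (perp P).range)ᗮ.starProjection
      = 1 - (⨆ K : 𝒦, (K : Submodule ℂ H)).topologicalClosure.starProjection := by
    rw [← hsup, ← Submodule.starProjection_orthogonal']
    congr 1
    exact (Submodule.orthogonal_closure _).symm
  rw [hG]
  let _ : TopologicalSpace (H →L[ℂ] H) :=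
    TopologicalSpace.induced (fun T : H →L[ℂ] H => (T : H → H)) Pi.topologicalSpace
  have hcl : IsClosed L := hL.strongly_closed
  refine hcl.mem_of_tendsto (b := atTop) (f := fun K : 𝒦 => 1 - (K : Submodule ℂ H).starProjection)
    ?_ (Eventually.of_forall fun K => (hperp K).2)
  rw [nhds_induced, tendsto_comap_iff, tendsto_pi_nhds]
  exact fun x => (hlim x).const_sub x

/-- In a continuous nest every projection `Φ` dominates the infimum of the `Q ∈ L` with `Q ≰ Φ`:
each predecessor of that infimum lies below `Φ`, and continuity makes it the supremum of its
predecessors. Dually, the complements of those `Q` span a dense part of the kernel of `Φ`. -/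
theorem IsContinuousNest.mem_closure_of_apply_eq_zero (hL : IsContinuousNest L) {Φ : H →L[ℂ] H}
    (hΦ : IsStarProjection Φ) {y : H} (hy : Φ y = 0) :
    y ∈ (⨆ Q ∈ {Q | Q ∈ L ∧ ¬ ProjLE Q Φ}, (perp Q).range).topologicalClosure := by
  set S : Set (H →L[ℂ] H) := {Q | Q ∈ L ∧ ¬ ProjLE Q Φ}
  set V := ⨆ Q ∈ S, (perp Q).range with hV
  have hGL : Vᗮ.starProjection ∈ L :=
    hL.toIsNest.starProjection_orthogonal_mem fun Q hQ => hQ.1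
  have hGproj := hL.isStarProjection _ hGL
  have hle : ProjLE Vᗮ.starProjection Φ := by
    rw [← hL.pred_eq _ hGL]
    refine projSup_projLE hΦ fun Q hQ => ⟨hL.isStarProjection Q hQ.1, ?_⟩
    by_contra hQΦ
    have hQp := hL.isStarProjection Q hQ.1
    refine hQ.2.2 (projLE_antisymm hQp hGproj hQ.2.1
      (projLE_of_forall_apply_eq_self hGproj hQp fun z hz => ?_))
    have hz' : z ∈ Vᗮ := Submodule.starProjection_eq_self_iff.mp hz
    have hzQ : perp Q z ∈ V :=
      (le_iSup₂ (f := fun (Q : H →L[ℂ] H) (_ : Q ∈ S) => (perp Q).range) Q ⟨hQ.1, hQΦ⟩) ⟨z, rfl⟩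
    have h0 : inner ℂ (perp Q z) (perp Q z) = 0 := by
      have hperp : IsStarProjection (perp Q) := hQp.one_sub
      rw [inner_apply_of_isStarProjection hperp, apply_apply_of_isStarProjection hperp]
      exact Submodule.inner_left_of_mem_orthogonal hzQ hz'
    have h1 : z - Q z = 0 := inner_self_eq_zero.mp h0
    exact (sub_eq_zero.mp h1).symm
  have h0 := hle.apply_eq_zero hy
  rw [Submodule.starProjection_apply_eq_zero_iff, Submodule.orthogonal_orthogonal_eq_closure] at h0
  exact h0

/-- A continuous nest is densely ordered. -/
theorem IsContinuousNest.exists_between (hL : IsContinuousNest L) {P Q : H →L[ℂ] H} (hP : P ∈ L)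
    (hQ : Q ∈ L) (hPQ : ProjLT P Q) : ∃ R ∈ L, ProjLT P R ∧ ProjLT R Q := by
  by_contra! hcon
  have hPp := hL.isStarProjection P hP
  have hQp := hL.isStarProjection Q hQ
  refine hPQ.2 (projLE_antisymm hPp hQp hPQ.1 ?_)
  rw [← hL.pred_eq Q hQ]
  refine projSup_projLE hPp fun R hR => ⟨hL.isStarProjection R hR.1, ?_⟩
  by_contra hRP
  have hPR : ProjLE P R := (hL.total P hP R hR.1).resolve_right hRP
  refine hcon R hR.1 ⟨hPR, ?_⟩ hR.2
  rintro rfl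
  exact hRP hPR

/-- The intervals of a continuous nest are infinite-dimensional, since a shortest
finite-dimensional one could be shortened further. -/
theorem IsContinuousNest.not_finiteDimensional (hL : IsContinuousNest L) {P Q : H →L[ℂ] H}
    (hP : P ∈ L) (hQ : Q ∈ L) (hPQ : ProjLT P Q) :
    ¬ FiniteDimensional ℂ ↥(Q.range ⊓ P.ker) := by
  intro hfin
  induction hn : Module.finrank ℂ ↥(Q.range ⊓ P.ker) using Nat.strong_induction_on
    generalizing Q with
  | _ n ih =>
    obtain ⟨R, hR, hPR, hRQ⟩ := hL.exists_between hP hQ hPQ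
    have hRp := hL.isStarProjection R hR
    have hQp := hL.isStarProjection Q hQ
    have hle : R.range ⊓ P.ker ≤ Q.range ⊓ P.ker := by
      refine inf_le_inf_right _ fun x hx => ?_
      rw [mem_range_iff_of_isStarProjection hQp]
      exact hRQ.1.apply_eq_self hRp hQp ((mem_range_iff_of_isStarProjection hRp).mp hx)
    have hne : R.range ⊓ P.ker ≠ Q.range ⊓ P.ker := by
      intro heq
      refine hRQ.2 (projLE_antisymm hRp hQp hRQ.1
        (projLE_of_forall_apply_eq_self hQp hRp fun x hx => ?_))
      have hxR : Q (x - R x) = x - R x := by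
        rw [map_sub, hx,
          hRQ.1.apply_eq_self hRp hQp (apply_apply_of_isStarProjection hRp x)]
      have hxP : P (x - R x) = 0 :=
        hPR.1.apply_eq_zero (by rw [map_sub, apply_apply_of_isStarProjection hRp, sub_self])
      have hmem : x - R x ∈ R.range ⊓ P.ker := heq ▸ ⟨⟨_, hxR⟩, hxP⟩
      have := (mem_range_iff_of_isStarProjection hRp).mp hmem.1
      rw [map_sub, apply_apply_of_isStarProjection hRp, sub_self] at this
      exact (sub_eq_zero.mp this.symm).symm
    have hlt := lt_of_le_of_ne hle hne
    exact ih _ (hn ▸ Submodule.finrank_lt_finrank_of_lt hlt) hR hPR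
      (Submodule.finiteDimensional_of_le hle) rfl

theorem IsNest.mem_nestAlgebra (hL : IsNest L) {P : H →L[ℂ] H} (hP : P ∈ L) :
    P ∈ nestAlgebra L := by
  intro R hR z hz
  have hPp := hL.isStarProjection P hP
  have hRp := hL.isStarProjection R hR
  rw [mem_range_iff_of_isStarProjection hRp] at hz ⊢
  rcases hL.total P hP R hR with h | h
  · exact h.apply_eq_self hPp hRp (apply_apply_of_isStarProjection hPp z)
  · rw [h.apply_eq_self hRp hPp hz, hz]

theorem IsNest.rankOne_mem_nestAlgebra (hL : IsNest L) {P : H →L[ℂ] H} (hP : P ∈ L) {x v : H}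
    (hx : P x = x) (hv : P v = 0) : rankOne ℂ x v ∈ nestAlgebra L := by
  intro R hR z hz
  have hPp := hL.isStarProjection P hP
  have hRp := hL.isStarProjection R hR
  rw [mem_range_iff_of_isStarProjection hRp] at hz ⊢
  rw [rankOne_apply, map_smul]
  rcases hL.total P hP R hR with h | h
  · rw [h.apply_eq_self hPp hRp hx]
  · rw [inner_eq_zero_of_isStarProjection hPp (h.apply_eq_self hRp hPp hz) hv, zero_smul, zero_smul]

end Nest

variable [CompleteSpace H] {L : Set (H →L[ℂ] H)} {M : Submodule ℂ (H →L[ℂ] H)}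
  {T P Q : H →L[ℂ] H}

/-! ### Commutators with projections and rank-one operators -/

/-- The lower off-diagonal block of an element of a Lie module belongs to the module, because
`X ↦ [X, P] + [[X, P], P]` is twice the compression `X ↦ P^⊥ X P`. -/
theorem IsLieNestModule.perp_mul_mul_mem (hM : IsLieNestModule L M) (hL : IsNest L) (hT : T ∈ M)
    (hP : P ∈ L) : perp P * T * P ∈ M := by
  have hPA := hL.mem_nestAlgebra hP
  have hD := hM T hT P hPA
  have hDD := hM _ hD P hPA
  have hPP : P * P = P := (hL.isStarProjection P hP).isIdempotentElem.eq
  have h := M.smul_mem (1 / 2 : ℂ) (M.add_mem hD hDD)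
  have heq : (1 / 2 : ℂ) • (T * P - P * T + ((T * P - P * T) * P - P * (T * P - P * T)))
      = perp P * T * P := by
    have e1 : T * P - P * T + ((T * P - P * T) * P - P * (T * P - P * T))
        = (2 : ℂ) • (perp P * T * P) := by
      have e2 : T * P * P = T * P := by rw [mul_assoc, hPP]
      have e3 : P * (P * T) = P * T := by rw [← mul_assoc, hPP]
      rw [two_smul, perp]
      simp only [sub_mul, mul_sub, one_mul, e2, e3, mul_assoc]
      abel
    rw [e1, smul_smul]
    norm_num
  exact heq ▸ h

/-- The double commutator of `T` with two rank-one operators `x ⊗ v` and `u ⊗ y` of the nest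
algebra, expanded. -/
theorem IsLieNestModule.rankOne_combination_mem (hM : IsLieNestModule L M) (hL : IsNest L)
    (hT : T ∈ M) (hP : P ∈ L) (hQ : Q ∈ L) {x v u y : H} (hx : P x = x) (hv : P v = 0)
    (hu : Q u = u) (hy : Q y = 0) :
    inner ℂ v (T u) • rankOne ℂ x y + inner ℂ y (T x) • rankOne ℂ u v
      - inner ℂ v u • rankOne ℂ (T x) y
      - inner ℂ y x • rankOne ℂ u (ContinuousLinearMap.adjoint T v) ∈ M := by
  have h := M.neg_mem (hM _ (hM T hT _ (hL.rankOne_mem_nestAlgebra hP hx hv)) _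
    (hL.rankOne_mem_nestAlgebra hQ hu hy))
  convert h using 1
  ext z
  simp only [sub_apply, add_apply, neg_apply, smul_apply, mul_apply_eq_comp, rankOne_apply,
    map_smul, map_sub, ContinuousLinearMap.adjoint_inner_left, smul_smul]
  module

/-! ### Rank-one operators produced by one nonzero corner -/

theorem exists_inner_ne_zero (hP : IsStarProjection P) (hQ : IsStarProjection Q)
    (h : perp P * T * Q ≠ 0) : ∃ u v, Q u = u ∧ P v = 0 ∧ inner ℂ v (T u) ≠ 0 := by
  obtain ⟨z, hz⟩ : ∃ z, perp P (T (Q z)) ≠ 0 := by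
    by_contra! hcon
    exact h (ContinuousLinearMap.ext hcon)
  have hperp : IsStarProjection (perp P) := hP.one_sub
  refine ⟨Q z, perp P (T (Q z)), apply_apply_of_isStarProjection hQ z, ?_, ?_⟩
  · simp [perp, apply_apply_of_isStarProjection hP]
  · rw [← apply_apply_of_isStarProjection hperp, inner_apply_of_isStarProjection hperp]
    exact inner_self_ne_zero.mpr hz

/-- A nonzero corner `P^⊥ T Q` of a finite-rank operator is not a scalar multiple of `P^⊥ Q`, as the
latter has infinite rank or vanishes. Hence a nonzero matrix entry of it can be found off the
diagonal. -/
theorem IsContinuousNest.exists_inner_ne_zero_inner_eq_zero (hL : IsContinuousNest L)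
    (hT : IsFiniteRank T) (hP : P ∈ L) (hQ : Q ∈ L) (hPQ : ProjLE P Q) (h : perp P * T * Q ≠ 0) :
    ∃ u v, Q u = u ∧ P v = 0 ∧ inner ℂ v (T u) ≠ 0 ∧ inner ℂ v u = 0 := by
  have hPp := hL.isStarProjection P hP
  have hQp := hL.isStarProjection Q hQ
  obtain ⟨u, v, hu, hv, huv⟩ := exists_inner_ne_zero hPp hQp h
  by_cases heq : P = Q
  · exact ⟨u, v, hu, hv, huv, inner_eq_zero_of_isStarProjection hQp hu (heq ▸ hv)⟩
  -- Adding to `u`, and to `v`, a multiple of a suitable `w` in `range Q ∩ ker P` makes `⟪v, u⟫`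
  -- vanish and does not change `⟪v, T u⟫`.
  obtain ⟨w, hwW, hw0, hTw, huw, htw⟩ := exists_ne_zero_mem_ker_orthogonal
    (hL.not_finiteDimensional hP hQ ⟨hPQ, heq⟩) hT u (T u)
  have hQw : Q w = w := (mem_range_iff_of_isStarProjection hQp).mp hwW.1
  have hPw : P w = 0 := hwW.2
  have hww : inner ℂ w w ≠ (0 : ℂ) := inner_self_ne_zero.mpr hw0
  have hwt : inner ℂ w (T u) = 0 := inner_eq_zero_symm.mp htw
  have hwu : inner ℂ w u = 0 := inner_eq_zero_symm.mp huw
  refine ⟨u + w, v - starRingEnd ℂ ((inner ℂ v u + inner ℂ v w) / inner ℂ w w) • w, ?_, ?_, ?_, ?_⟩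
  · rw [map_add, hu, hQw]
  · rw [map_sub, map_smul, hv, hPw, smul_zero, sub_zero]
  · rwa [map_add, hTw, add_zero, inner_sub_left, inner_smul_left, hwt, mul_zero, sub_zero]
  · rw [inner_sub_left, inner_smul_left, inner_add_right, inner_add_right, hwu, zero_add,
      Complex.conj_conj, div_mul_cancel₀ _ hww, sub_self]

/-- The corner lemma for comparable `P ≤ Q`. -/
theorem IsLieNestModule.rankOne_mem_of_projLE (hM : IsLieNestModule L M) (hL : IsContinuousNest L)
    (hTM : T ∈ M) (hT : IsFiniteRank T) (hP : P ∈ L) (hQ : Q ∈ L) (hPQ : ProjLE P Q)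
    (h : perp P * T * Q ≠ 0) {x y : H} (hx : P x = x) (hy : Q y = 0) : rankOne ℂ x y ∈ M := by
  have hPp := hL.isStarProjection P hP
  have hQp := hL.isStarProjection Q hQ
  have hyx : ∀ {x y : H}, P x = x → Q y = 0 → inner ℂ y x = 0 := fun hx hy =>
    inner_eq_zero_of_isStarProjection hQp (hPQ.apply_eq_self hPp hQp hx) hy
  by_cases hQTP : perp Q * T * P = 0
  · obtain ⟨u, v, hu, hv, huv, hvu⟩ :=
      hL.exists_inner_ne_zero_inner_eq_zero hT hP hQ hPQ h
    have hyTx : inner ℂ y (T x) = 0 := by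
      have h1 : T x - Q (T x) = 0 := by
        have := congrArg (fun A : H →L[ℂ] H => A x) hQTP
        simpa [perp, hx] using this
      exact inner_eq_zero_of_isStarProjection hQp (sub_eq_zero.mp h1).symm hy
    have hmem := hM.rankOne_combination_mem hL.toIsNest hTM hP hQ hx hv hu hy
    simp only [hyTx, hvu, hyx hx hy, zero_smul, add_zero, sub_zero] at hmem
    exact (M.smul_mem_iff huv).mp hmem
  · obtain ⟨u, v, hu, hv, huv⟩ := exists_inner_ne_zero hQp hPp hQTP
    have hcomb : ∀ {x y : H}, P x = x → Q y = 0 →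
        inner ℂ v (T u) • rankOne ℂ x y + inner ℂ y (T x) • rankOne ℂ u v ∈ M := by
      intro x y hx hy
      have hmem := hM.rankOne_combination_mem hL.toIsNest hTM hP hQ hx (hPQ.apply_eq_zero hv)
        (hPQ.apply_eq_self hPp hQp hu) hy
      simpa only [hyx hx hy, hyx hu hv, zero_smul, sub_zero] using hmem
    -- Both terms of the combination coincide for `x = u` and `y = v`.
    have huvM : rankOne ℂ u v ∈ M := by
      have := hcomb hu hv
      rw [← add_smul, ← two_mul] at this
      exact (M.smul_mem_iff (mul_ne_zero two_ne_zero huv)).mp this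
    exact (M.smul_mem_iff huv).mp
      ((M.add_mem_iff_left (M.smul_mem _ huvM)).mp (hcomb hx hy))

/-- For `Q < P` and a nonzero corner `P^⊥ T Q`, the module contains `x ⊗ y` for all `x` in the
infinite-dimensional range of `P - Q` and all `y` in the kernel of `Q`. The double commutators only
give `c • x ⊗ y - ⟪y, x⟫ • B` with a fixed operator `B`. Averaging over `n` orthonormal vectors
`x = y` leaves `(c / n) • E - B` with a projection `E`, whence `B` lies in the closed subspace
`M`. -/
theorem IsLieNestModule.rankOne_mem_of_mem_interval (hM : IsLieNestModule L M)
    (hMcl : IsClosed (M : Set (H →L[ℂ] H))) (hL : IsContinuousNest L) (hTM : T ∈ M)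
    (hP : P ∈ L) (hQ : Q ∈ L) (hQP : ProjLT Q P) (h : perp P * T * Q ≠ 0) {x y : H}
    (hx : P x = x) (hx' : Q x = 0) (hy : Q y = 0) : rankOne ℂ x y ∈ M := by
  have hPp := hL.isStarProjection P hP
  have hQp := hL.isStarProjection Q hQ
  have hPQ' : P * Q = Q := by
    ext z
    exact hQP.1.apply_eq_self hQp hPp (apply_apply_of_isStarProjection hQp z)
  -- Only the corner of `T` matters, and it annihilates the range of `P - Q`.
  have hSM : perp P * T * Q ∈ M := by
    have h1 := hM.perp_mul_mul_mem hL.toIsNest (hM.perp_mul_mul_mem hL.toIsNest hTM hP) hQ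
    convert h1 using 1
    have h2 : perp Q * perp P = perp P := by
      have : Q * P = Q := hQP.1
      simp [perp, sub_mul, mul_sub, this]
    rw [← mul_assoc, ← mul_assoc, h2, mul_assoc _ P Q, hPQ']
  set S := perp P * T * Q with hS
  have hSx : ∀ {x : H}, Q x = 0 → S x = 0 := fun {x} hx => by
    simp [hS, hx]
  obtain ⟨u, v, hu, hv, huv⟩ := exists_inner_ne_zero hPp hQp h
  have huv' : inner ℂ v (S u) ≠ 0 := by
    have : inner ℂ v (S u) = inner ℂ v (T u) := by
      simp [hS, hu, perp, ← inner_apply_of_isStarProjection hPp, hv]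
    rwa [this]
  set c : ℂ := inner ℂ v (S u)
  set B : H →L[ℂ] H := rankOne ℂ u (ContinuousLinearMap.adjoint S v)
  have hvu : inner ℂ v u = 0 :=
    inner_eq_zero_of_isStarProjection hPp (hQP.1.apply_eq_self hQp hPp hu) hv
  have hcomb : ∀ {x y : H}, P x = x → Q x = 0 → Q y = 0 →
      c • rankOne ℂ x y - inner ℂ y x • B ∈ M := by
    intro x y hx hx' hy
    have hmem := hM.rankOne_combination_mem hL.toIsNest hSM hP hQ hx hv hu hy
    simpa only [hSx hx', inner_zero_right, hvu, zero_smul, add_zero, sub_zero] using hmem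
  have hseq : ∀ n : ℕ, ∃ E : H →L[ℂ] H, ‖E‖ ≤ 1 ∧ c • E - (n : ℂ) • B ∈ M := by
    intro n
    obtain ⟨K, hK, hfin, hn⟩ := exists_finrank_eq_of_not_finiteDimensional
      (hL.not_finiteDimensional hQ hP hQP) n
    let b := stdOrthonormalBasis ℂ K
    refine ⟨K.starProjection, K.starProjection_norm_le, ?_⟩
    have hsum := M.sum_mem (t := Finset.univ) fun i _ =>
      hcomb ((mem_range_iff_of_isStarProjection hPp).mp (hK (b i).2).1) (hK (b i).2).2
        (hK (b i).2).2
    have hb : ∀ i, inner ℂ (b i : H) (b i : H) = (1 : ℂ) := fun i => by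
      have := b.orthonormal.1 i
      rw [inner_self_eq_norm_sq_to_K, Submodule.norm_coe, this]
      simp
    simp only [hb, one_smul, Finset.sum_sub_distrib, ← Finset.smul_sum,
      ← b.starProjection_eq_sum_rankOne, Finset.sum_const, Finset.card_univ, Fintype.card_fin, hn]
      at hsum
    rwa [Nat.cast_smul_eq_nsmul]
  have hBM : B ∈ M := by
    choose E hE hEM using hseq
    have hlim : Tendsto (fun n : ℕ => B - (((n : ℝ) + 1)⁻¹ : ℝ) • (c • E (n + 1))) atTop
        (𝓝 (B - 0)) := by
      refine tendsto_const_nhds.sub ?_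
      refine squeeze_zero_norm (a := fun n : ℕ => (1 / ((n : ℝ) + 1)) * ‖c‖) (fun n => ?_) ?_
      · rw [norm_smul, norm_smul, Real.norm_of_nonneg (by positivity), one_div]
        gcongr
        exact mul_le_of_le_one_right (norm_nonneg c) (hE _)
      · simpa using tendsto_one_div_add_atTop_nhds_zero_nat.mul_const ‖c‖
    rw [sub_zero] at hlim
    refine hMcl.mem_of_tendsto hlim (Eventually.of_forall fun n => ?_)
    have hn : ((n : ℂ) + 1) ≠ 0 := Nat.cast_add_one_ne_zero n
    have := M.smul_mem (-((n : ℂ) + 1)⁻¹) (hEM (n + 1))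
    rw [SetLike.mem_coe]
    convert this using 1
    rw [smul_sub, smul_smul (-((n : ℂ) + 1)⁻¹) ((n + 1 : ℕ) : ℂ), Nat.cast_add_one, neg_mul,
      inv_mul_cancel₀ hn, neg_smul, neg_smul, one_smul, ← Complex.coe_smul]
    push_cast
    abel
  exact (M.smul_mem_iff huv').mp
    ((M.sub_mem_iff_left (M.smul_mem _ hBM)).mp (hcomb hx hx' hy))

/-- If the corner `P^⊥ T Q` of a finite-rank element of a closed Lie module is nonzero, then the
module contains all rank-one operators of `P B(H) Q^⊥`. -/
theorem IsLieNestModule.rankOne_mem (hM : IsLieNestModule L M)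
    (hMcl : IsClosed (M : Set (H →L[ℂ] H))) (hL : IsContinuousNest L) (hTM : T ∈ M)
    (hT : IsFiniteRank T) (hP : P ∈ L) (hQ : Q ∈ L) (h : perp P * T * Q ≠ 0) {x y : H}
    (hx : P x = x) (hy : Q y = 0) : rankOne ℂ x y ∈ M := by
  have hPp := hL.isStarProjection P hP
  have hQp := hL.isStarProjection Q hQ
  by_cases hPQ : ProjLE P Q
  · exact hM.rankOne_mem_of_projLE hL hTM hT hP hQ hPQ h hx hy
  have hQP : ProjLE Q P := (hL.total P hP Q hQ).resolve_left hPQ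
  have hlt : ProjLT Q P := ⟨hQP, fun heq => hPQ (heq ▸ hQP)⟩
  have hrefl : ∀ {R : H →L[ℂ] H}, R ∈ L → ProjLE R R := fun hR =>
    (hL.isStarProjection _ hR).isIdempotentElem.eq
  have hPQ' : P * Q = Q := by
    ext z
    exact hQP.apply_eq_self hQp hPp (apply_apply_of_isStarProjection hQp z)
  have hP' : perp P * T * P ≠ 0 := fun h0 => h (by rw [← hPQ', ← mul_assoc, h0, zero_mul])
  have hQ' : perp Q * T * Q ≠ 0 := fun h0 => h (by
    have h2 : perp P * perp Q = perp P := by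
      simp [perp, sub_mul, mul_sub, hPQ']
    rw [← h2, mul_assoc, mul_assoc, ← mul_assoc (perp Q), h0, mul_zero])
  have h1 : rankOne ℂ (Q x) y ∈ M := hM.rankOne_mem_of_projLE hL hTM hT hQ hQ (hrefl hQ) hQ'
    (apply_apply_of_isStarProjection hQp x) hy
  have hPx : P (x - Q x) = x - Q x := by
    rw [map_sub, hx, hQP.apply_eq_self hQp hPp (apply_apply_of_isStarProjection hQp x)]
  have hQx : Q (x - Q x) = 0 := by rw [map_sub, apply_apply_of_isStarProjection hQp, sub_self]
  have h2 : rankOne ℂ (x - Q x) (y - P y) ∈ M :=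
    hM.rankOne_mem_of_projLE hL hTM hT hP hP (hrefl hP) hP' hPx
      (by rw [map_sub, apply_apply_of_isStarProjection hPp, sub_self])
  have hQPy : Q (P y) = 0 := by
    have : Q (P y) = Q y := congrArg (fun A : H →L[ℂ] H => A y) hQP
    rw [this, hy]
  have h3 : rankOne ℂ (x - Q x) (P y) ∈ M :=
    hM.rankOne_mem_of_mem_interval hMcl hL hTM hP hQ hlt h hPx hQx hQPy
  have hsum := M.add_mem h1 (M.add_mem h2 h3)
  simpa only [map_sub, sub_apply, sub_add_cancel, add_sub_cancel] using hsum

/-! ### The kernel map -/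

/-- If `R ≤ P₀` (as `P₀^⊥ R^⊥ = P₀^⊥`) and `φ_T(P) = φ_T(R)`, then `P^⊥ T Q = 0` forces
`Q ≤ φ_T(R) ≤ φ_T(P₀)`. It does not matter whether `R` lies in `L`; if it does not, then
`φ_T(R) = 0` because no pair belongs to `BIL(T, L)`. -/
theorem perp_mul_mul_ne_zero {R P₀ : H →L[ℂ] H} (hL : IsNest L) (hP₀ : P₀ ∈ L) (hP : P ∈ L)
    (hQ : Q ∈ L) (hR : perp P₀ * perp R = perp P₀) (hPR : phi T L P = phi T L R)
    (hQΦ : ¬ ProjLE Q (phi T L P₀)) : perp P * T * Q ≠ 0 := by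
  intro h0
  have hQp := hL.isStarProjection Q hQ
  have hQR : ProjLE Q (phi T L R) := hPR ▸ projLE_projSup hQp ⟨hQ, hQ, ⟨P, hP, rfl⟩, h0⟩
  have hker : (phi T L R).range ≤ (perp P₀ * T).ker := by
    refine range_projSup_le (perp P₀ * T).isClosed_ker ?_
    rintro P' ⟨-, -, -, hP'⟩ _ ⟨z, rfl⟩
    have h1 : perp P₀ * T * P' = 0 := by
      rw [← hR, mul_assoc (perp P₀), mul_assoc (perp P₀), hP', mul_zero]
    exact congrArg (fun A : H →L[ℂ] H => A z) h1
  have h2 : perp P₀ * T * Q = 0 := by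
    ext z
    have hz := hQR.apply_eq_self hQp (projSup_isStarProjection _)
      (apply_apply_of_isStarProjection hQp z)
    exact hker ⟨_, hz⟩
  exact hQΦ (projLE_projSup hQp ⟨hQ, hQ, ⟨P₀, hP₀, rfl⟩, h2⟩)

end NestLie

open NestLie in
theorem theorem3p5 {H : Type*} [NormedAddCommGroup H] [InnerProductSpace ℂ H] [CompleteSpace H]
    [TopologicalSpace.SeparableSpace H]
    (L : Set (H →L[ℂ] H)) (hL : NestLie.IsContinuousNest L)
    (M : Submodule ℂ (H →L[ℂ] H)) (hMclosed : IsClosed (M : Set (H →L[ℂ] H)))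
    (hMLie : NestLie.IsLieNestModule L M)
    (T : H →L[ℂ] H) (hTM : T ∈ M) (hT : NestLie.IsFiniteRank T)
    (Φ Ψ : H →L[ℂ] H) (hΩ : (Φ, Ψ) ∈ NestLie.kernelSet T L) :
    ∀ A ∈ NestLie.corner (NestLie.sigmaProj T L (NestLie.perp Ψ)) (NestLie.perp Φ),
      NestLie.IsRankOne A → A ∈ M := by
  obtain ⟨P₀, hP₀, hΦΨ⟩ := hΩ
  obtain ⟨rfl, rfl⟩ : phi T L P₀ = Φ ∧ psi T L P₀ = Ψ := Prod.mk.inj hΦΨ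
  have hΦp : IsStarProjection (phi T L P₀) := projSup_isStarProjection _
  have hR : perp P₀ * perp (perp (psi T L P₀)) = perp P₀ := by
    have hle : ProjLE (perp P₀) (psi T L P₀) :=
      projLE_projSup (hL.isStarProjection P₀ hP₀).one_sub ⟨P₀, ⟨hP₀, rfl⟩, rfl⟩
    have hpp : perp (perp (psi T L P₀)) = psi T L P₀ := by simp [perp]
    rw [hpp]
    exact hle
  rintro A ⟨X, hAdef⟩ hA
  change _ * X * _ = A at hAdef
  obtain ⟨z, c, hzc⟩ := hA.exists_eq_rankOne
  rw [hzc]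
  have hrange : A z ∈ (sigmaProj T L (perp (psi T L P₀))).range :=
    ⟨X (perp (phi T L P₀) z), congrArg (fun B : H →L[ℂ] H => B z) hAdef⟩
  rw [sigmaProj, range_projSup] at hrange
  have hker : phi T L P₀ (c • ContinuousLinearMap.adjoint A (A z)) = 0 := by
    have h0 : A * phi T L P₀ = 0 := by
      have h1 : perp (phi T L P₀) * phi T L P₀ = 0 := by
        rw [perp, sub_mul, one_mul, hΦp.isIdempotentElem.eq, sub_self]
      rw [← hAdef, mul_assoc, h1, mul_zero]
    have h1 := congrArg star h0
    rw [star_mul, hΦp.isSelfAdjoint.star_eq, star_zero] at h1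
    rw [map_smul]
    exact (congrArg (c • ·) (congrArg (fun B : H →L[ℂ] H => B (A z)) h1)).trans (smul_zero c)
  refine rankOne_mem_of_mem_closure hMclosed ?_ hrange
    (hL.mem_closure_of_apply_eq_zero hΦp hker)
  rintro P ⟨hP, hPφ⟩ Q ⟨hQ, hQφ⟩ x hx _ ⟨w, rfl⟩
  have hQp := hL.isStarProjection Q hQ
  refine hMLie.rankOne_mem hMclosed hL hTM hT hP hQ
    (perp_mul_mul_ne_zero hL.toIsNest hP₀ hP hQ hR hPφ hQφ)
    ((mem_range_iff_of_isStarProjection (hL.isStarProjection P hP)).mp hx) ?_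
  simp [perp, apply_apply_of_isStarProjection hQp]
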